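/- Let $\mathbb F\in\{\mathbb Q,\mathbb R,\mathbb C\}$. A p-family $(f)=(f_n)_{n\in\mathbb N}$ is a sequence of multivariate polynomials over $\mathbb F$ whose numbers of variables and degrees are polynomially bounded in $n$. For polynomials over a field, $f\le g$ means that $f$ arises from $g$ by substituting for each variable of $g$ a variable of $f$ or a field constant. $L^g(f)$ is the minimum number of nodes of an algebraic circuit (with leaves labelled by variables and field constants, and with $+$, $\times$ and $g$-oracle gates) that computes $f$. For $f,g$ over $\mathbb F$, $f\trianglelefteq g$ means that $f+\varepsilon h\le g$ over $\mathbb F(\varepsilon)$ for some polynomial $h$ over $\mathbb F[\varepsilon]$, and $\overline{L^g}(f)$ is the minimum over all polynomials $h$ over $\mathbb F[\varepsilon]$ of $L^g(f+\varepsilon h)$, taken over $\mathbb F(\varepsilon)$. For families, $(f)\le_{\mathsf p}(g)$, $(f)\trianglelefteq_{\mathsf p}(g)$, $(f)\le_{\mathsf c}(g)$, $(f)\trianglelefteq_{\mathsf c}(g)$ mean that there is a polynomially bounded $t:\mathbb N\to\mathbb N$ such that, respectively, $f_n\le g_{t(n)}$ for all $n$; $f_n\trianglelefteq g_{t(n)}$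 for all $n$; $L^{g_{t(n)}}(f_n)$ is polynomially bounded in $n$; $\overline{L^{g_{t(n)}}}(f_n)$ is polynomially bounded in $n$. Let $\mathrm{HC}_n=\sum_{\pi}\prod_{i=1}^n x_{i,\pi(i)}$, where $\pi$ runs over the cycles of length $n$ in the symmetric group on $n$ symbols. Let $\mathrm{VNP}$ be the set of p-families $(f)$ with $(f)\le_{\mathsf p}(\mathrm{HC})$, and for each of the four reductions $\preceq$ let $\mathrm{VNPC}(\preceq)=\{(f)\in\mathrm{VNP} : (\mathrm{HC})\preceq(f)\}$. Then the following inclusions hold: $\mathrm{VNPC}(\le_{\mathsf p})\subseteq\mathrm{VNPC}(\le_{\mathsf c})$, $\mathrm{VNPC}(\le_{\mathsf p})\subseteq\mathrm{VNPC}(\trianglelefteq_{\mathsf p})$, $\mathrm{VNPC}(\le_{\mathsf c})\subseteq\mathrm{VNPC}(\trianglelefteq_{\mathsf c})$, $\mathrm{VNPC}(\trianglelefteq_{\mathsf p})\subseteq\mathrm{VNPC}(\trianglelefteq_{\mathsf c})$. The following inclusions fail: $\mathrm{VNPC}(\le_{\mathsf c})\not\subseteq\mathrm{VNPC}(\le_{\mathsf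 p})$, $\mathrm{VNPC}(\trianglelefteq_{\mathsf p})\not\subseteq\mathrm{VNPC}(\le_{\mathsf p})$, $\mathrm{VNPC}(\le_{\mathsf c})\not\subseteq\mathrm{VNPC}(\trianglelefteq_{\mathsf p})$, $\mathrm{VNPC}(\trianglelefteq_{\mathsf c})\not\subseteq\mathrm{VNPC}(\trianglelefteq_{\mathsf p})$. More precisely, $(\mathrm{HC}_n^2)_n\in\mathrm{VNPC}(\le_{\mathsf c})\setminus\mathrm{VNPC}(\trianglelefteq_{\mathsf p})$, and the family $P_n=z^2(y\,\mathrm{HC}_n+y^2\,\mathrm{HC}_n^2)$, with $y,z$ two variables that do not occur in $\mathrm{HC}_n$, satisfies $(P)\in\mathrm{VNPC}(\trianglelefteq_{\mathsf p})\setminus\mathrm{VNPC}(\le_{\mathsf p})$. -/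

import Mathlib

namespace AlgRed

open MvPolynomial

/-! ### Families of polynomials -/

/-- A sequence `(f) = (f_n)` of multivariate polynomials over `F`, where `f_n` is a polynomial in
`nvars n` variables. -/
structure PolyFamily (F : Type*) [Field F] where
  /-- the number of variables of `f_n` -/
  nvars : ℕ → ℕ
  /-- the polynomial `f_n` -/
  poly : (n : ℕ) → MvPolynomial (Fin (nvars n)) F

/-- A sequence of natural numbers is polynomially bounded. -/
def PolyBounded (t : ℕ → ℕ) : Prop :=
  ∃ p : Polynomial ℕ, ∀ n, t n ≤ p.eval n

/-- p-families: the number of variables and the degree are polynomially bounded. -/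
def IsPFamily {F : Type*} [Field F] (f : PolyFamily F) : Prop :=
  PolyBounded f.nvars ∧ PolyBounded fun n => (f.poly n).totalDegree

/-! ### Projections -/

/-- `f` is a projection of `g`: it arises from `g` by substituting for every variable
a variable or a field constant. -/
def IsProjection {K : Type*} [Field K] {N M : ℕ}
    (f : MvPolynomial (Fin N) K) (g : MvPolynomial (Fin M) K) : Prop :=
  ∃ α : Fin M → Fin N ⊕ K, f = aeval (fun i => Sum.elim X C (α i)) g

/-- `(f) ≤_p (g)`. -/
def PProj {F : Type*} [Field F] (f g : PolyFamily F) : Prop :=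
  ∃ t : ℕ → ℕ, PolyBounded t ∧ ∀ n, IsProjection (f.poly n) (g.poly (t n))

/-! ### Oracle circuits -/

/-- The nodes that can be added to a circuit which already has `s` nodes: leaves (variables or
constants), addition and multiplication gates, and oracle gates of arity `M`; the inputs of a gate
are nodes that are already there. -/
inductive Gate (K : Type*) (N M s : ℕ) where
  | var (j : Fin N)
  | const (c : K)
  | add (a b : Fin s)
  | mul (a b : Fin s)
  | oracle (a : Fin M → Fin s)

/-- Circuits with `s` nodes (leaves included) in the variables `x_1, …, x_N` with oracle gates of
arity `M`: directed acyclic graphs whose nodes are listed in a topological order. -/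
inductive Circuit (K : Type*) (N M : ℕ) : ℕ → Type _ where
  | empty : Circuit K N M 0
  | snoc {s : ℕ} (c : Circuit K N M s) (γ : Gate K N M s) : Circuit K N M (s + 1)

/-- The polynomial computed at a node, given the polynomials computed at the earlier nodes. -/
noncomputable def Gate.value {K : Type*} [Field K] {N M s : ℕ} (g : MvPolynomial (Fin M) K)
    (v : Fin s → MvPolynomial (Fin N) K) : Gate K N M s → MvPolynomial (Fin N) K
  | .var j => X j
  | .const c => C c
  | .add a b => v a + v b
  | .mul a b => v a * v b
  | .oracle a => aeval (fun i => v (a i)) g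

/-- The polynomials computed at the nodes of a circuit with oracle `g`. -/
noncomputable def Circuit.values {K : Type*} [Field K] {N M : ℕ} (g : MvPolynomial (Fin M) K) :
    {s : ℕ} → Circuit K N M s → Fin s → MvPolynomial (Fin N) K
  | _, .empty => Fin.elim0
  | _, .snoc c γ =>
      Fin.snoc (α := fun _ => MvPolynomial (Fin N) K) (c.values g) (γ.value g (c.values g))

/-- Some circuit with `s` nodes and `g`-oracle gates computes `f` at one of its nodes, the root. -/
def ComputableWithSize {K : Type*} [Field K] {N M : ℕ}
    (g : MvPolynomial (Fin M) K) (f : MvPolynomial (Fin N) K) (s : ℕ) : Prop :=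
  ∃ (c : Circuit K N M s) (root : Fin s), c.values g root = f

/-- The oracle complexity `L^g(f)`: the minimum size of a circuit with `g`-oracle gates that
computes `f`. -/
noncomputable def oracleComplexity {K : Type*} [Field K] {N M : ℕ}
    (g : MvPolynomial (Fin M) K) (f : MvPolynomial (Fin N) K) : ℕ :=
  sInf {s | ComputableWithSize g f s}

/-- Every circuit can be extended so that it also computes a given polynomial. -/
theorem Circuit.exists_extension {K : Type*} [Field K] {N M : ℕ} (g : MvPolynomial (Fin M) K)
    (f : MvPolynomial (Fin N) K) : ∀ {s : ℕ} (c : Circuit K N M s),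
      ∃ (s' : ℕ) (c' : Circuit K N M s') (e : Fin s → Fin s') (j : Fin s'),
        (∀ i, c'.values g (e i) = c.values g i) ∧ c'.values g j = f := by
  induction f using MvPolynomial.induction_on with
  | C a =>
    intro s c
    exact ⟨_, c.snoc (.const a), Fin.castSucc, Fin.last _,
      fun i => by simp [Circuit.values], by simp [Circuit.values, Gate.value]⟩
  | add p q hp hq =>
    intro s c
    obtain ⟨s₁, c₁, e₁, j₁, h₁, k₁⟩ := hp c
    obtain ⟨s₂, c₂, e₂, j₂, h₂, k₂⟩ := hq c₁
    exact ⟨_, c₂.snoc (.add (e₂ j₁) j₂), fun i => (e₂ (e₁ i)).castSucc, Fin.last _,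
      fun i => by simp [Circuit.values, h₁, h₂], by simp [Circuit.values, Gate.value, h₂, k₁, k₂]⟩
  | mul_X p n hp =>
    intro s c
    obtain ⟨s₁, c₁, e₁, j₁, h₁, k₁⟩ := hp c
    exact ⟨_, (c₁.snoc (.var n)).snoc (.mul j₁.castSucc (Fin.last _)),
      fun i => (e₁ i).castSucc.castSucc, Fin.last _,
      fun i => by simp [Circuit.values, h₁], by simp [Circuit.values, Gate.value, k₁]⟩

/-- The minimum in the definition of the oracle complexity is taken over a nonempty set. -/
theorem exists_computableWithSize {K : Type*} [Field K] {N M : ℕ}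
    (g : MvPolynomial (Fin M) K) (f : MvPolynomial (Fin N) K) :
    ∃ s, ComputableWithSize g f s := by
  obtain ⟨s, c, -, j, -, h⟩ := Circuit.exists_extension g f (Circuit.empty (K := K))
  exact ⟨s, c, j, h⟩

/-- `(f) ≤_c (g)`. -/
def CRed {F : Type*} [Field F] (f g : PolyFamily F) : Prop :=
  ∃ t : ℕ → ℕ, PolyBounded t ∧
    PolyBounded fun n => oracleComplexity (g.poly (t n)) (f.poly n)

/-! ### Border reductions -/

/-- A polynomial over `F`, viewed over `F(ε)`. -/
noncomputable def extend {F : Type*} [Field F] {N : ℕ} (f : MvPolynomial (Fin N) F) :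
    MvPolynomial (Fin N) (RatFunc F) :=
  map RatFunc.C f

/-- `f + ε h` as a polynomial over `F(ε)`, for `f` over `F` and `h` over `F[ε]`. -/
noncomputable def perturb {F : Type*} [Field F] {N : ℕ} (f : MvPolynomial (Fin N) F)
    (h : MvPolynomial (Fin N) (Polynomial F)) : MvPolynomial (Fin N) (RatFunc F) :=
  extend f + C RatFunc.X * map (algebraMap (Polynomial F) (RatFunc F)) h

/-- `f ⊴ g`: border projections. -/
def IsBorderProjection {F : Type*} [Field F] {N M : ℕ}
    (f : MvPolynomial (Fin N) F) (g : MvPolynomial (Fin M) F) : Prop :=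
  ∃ h : MvPolynomial (Fin N) (Polynomial F), IsProjection (perturb f h) (extend g)

/-- `(f) ⊴_p (g)`. -/
def BorderPProj {F : Type*} [Field F] (f g : PolyFamily F) : Prop :=
  ∃ t : ℕ → ℕ, PolyBounded t ∧ ∀ n, IsBorderProjection (f.poly n) (g.poly (t n))

/-- The border oracle complexity of `f` with oracle `g`: the smallest `c` such that
`L^g(f + ε h) ≤ c` over `F(ε)` for some `h` over `F[ε]`. -/
noncomputable def borderOracleComplexity {F : Type*} [Field F] {N M : ℕ}
    (g : MvPolynomial (Fin M) F) (f : MvPolynomial (Fin N) F) : ℕ :=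
  sInf {c | ∃ h : MvPolynomial (Fin N) (Polynomial F),
    oracleComplexity (extend g) (perturb f h) ≤ c}

/-- `(f) ⊴_c (g)`. -/
def BorderCRed {F : Type*} [Field F] (f g : PolyFamily F) : Prop :=
  ∃ t : ℕ → ℕ, PolyBounded t ∧
    PolyBounded fun n => borderOracleComplexity (g.poly (t n)) (f.poly n)

/-! ### The Hamiltonian cycle family, VNP and VNP-completeness -/

/-- The cycles of length `n` in the symmetric group on `n` symbols: the permutations
with a single orbit (for `n = 1`, the identity). -/
def fullCycles (n : ℕ) : Finset (Equiv.Perm (Fin n)) :=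
  Finset.univ.filter fun π => ∀ i j, π.SameCycle i j

/-- `HC_n = ∑_{π ∈ C_n} ∏_i x_{i,π(i)}`, where the `n²` variables `x_{i,j}` are numbered by
`finProdFinEquiv`. -/
noncomputable def hcPoly (F : Type*) [Field F] (n : ℕ) : MvPolynomial (Fin (n * n)) F :=
  ∑ π ∈ fullCycles n, ∏ i, X (finProdFinEquiv (i, π i))

/-- The Hamiltonian cycle family `(HC)`. -/
noncomputable def HC (F : Type*) [Field F] : PolyFamily F where
  nvars n := n * n
  poly n := hcPoly F n

/-- The family `(HC²)` of the squares `HC_n²`. -/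
noncomputable def HCsq (F : Type*) [Field F] : PolyFamily F where
  nvars n := n * n
  poly n := hcPoly F n ^ 2

/-- The family `(P)` with `P_n = z² (y HC_n + y² HC_n²)`, where `y` and `z` are two variables
outside the variables of `HC_n`. -/
noncomputable def PFam (F : Type*) [Field F] : PolyFamily F where
  nvars n := n * n + 2
  poly n :=
    let y : MvPolynomial (Fin (n * n + 2)) F := X (Fin.natAdd (n * n) 0)
    let z : MvPolynomial (Fin (n * n + 2)) F := X (Fin.natAdd (n * n) 1)
    let hc : MvPolynomial (Fin (n * n + 2)) F := rename (Fin.castAdd 2) (hcPoly F n)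
    z ^ 2 * (y * hc + y ^ 2 * hc ^ 2)

/-- `VNP`: the p-families that are p-projections of `(HC)`. -/
def VNP (F : Type*) [Field F] : Set (PolyFamily F) :=
  {f | IsPFamily f ∧ PProj f (HC F)}

/-- `VNPC(≼)`: the families in `VNP` to which `(HC)` reduces under the reduction notion `≼`. -/
def VNPC {F : Type*} [Field F] (red : PolyFamily F → PolyFamily F → Prop) :
    Set (PolyFamily F) :=
  {f | f ∈ VNP F ∧ red (HC F) f}

end AlgRed

open AlgRed

/-!
Two Hamiltonian cycles are joined into one by exchanging two arrows, and replacing every vertex by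
a path of three vertices forces a Hamiltonian cycle to run through all of these paths forwards or
through all of them backwards. Hence products and sums of projections of `HC` are again projections
of `HC`, of polynomially larger index; this puts `HC²` and `z² (y f + y² f²)`, for `f = HC_n`, into
`VNP`.

Two calls of the oracle `HC²` recover `f` by polarisation, `4 f = (1 + f)² - (1 - f)²`, and the
substitution `y = ε²`, `z = ε⁻¹` turns `z² (y f + y² f²)` into `f + ε² f²`.

As for the obstructions, `F[ε]` is integrally closed in `F(ε)`, so that a square root over `F(ε)` of
`f + ε h` has coefficients in `F[ε]`, and putting `ε = 0` shows that a border projection of a square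
is a square. Every univariate specialisation of a projection of `z² (y f + y² f²)` has the form
`a² (u + u²)`, whose degree is even. But `HC_1` is a single variable, which is not a square and
specialises to a polynomial of degree one.
-/

namespace AlgRed

open MvPolynomial Equiv

section FullCycles

variable {ι κ : Type*}

/-- The permutation `π` has a single orbit. This is the condition that defines `fullCycles`, over an
arbitrary index type: closure of `HC` under sums and products is proved on index types other than
`Fin n`. -/
def IsFullCycle (π : Perm ι) : Prop := ∀ i j, π.SameCycle i j

theorem IsFullCycle.of_sameCycle {π : Perm ι} (i : ι) (h : ∀ j, π.SameCycle i j) :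
    IsFullCycle π := fun j k => (h j).symm.trans (h k)

theorem IsFullCycle.mem_of_mapsTo [Finite ι] {π : Perm ι} (hπ : IsFullCycle π) {S : Set ι}
    (hS : Set.MapsTo π S S) {i : ι} (hi : i ∈ S) (j : ι) : j ∈ S := by
  obtain ⟨k, rfl⟩ := (hπ i j).exists_nat_pow_eq
  rw [← Perm.iterate_eq_pow]
  exact hS.iterate k hi

theorem IsFullCycle.eq_or_eq_of_two_cycle [Finite ι] {π : Perm ι} (hπ : IsFullCycle π) {i j : ι}
    (hij : π i = j) (hji : π j = i) (k : ι) : k = i ∨ k = j := by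
  refine hπ.mem_of_mapsTo (S := {i, j}) ?_ (Set.mem_insert i _) k
  rintro _ (rfl | rfl)
  · exact Or.inr hij
  · exact Or.inl hji

theorem sameCycle_permCongr (e : ι ≃ κ) (π : Perm ι) (i j : ι) :
    (e.permCongr π).SameCycle (e i) (e j) ↔ π.SameCycle i j := by
  refine exists_congr fun k => ?_
  rw [show e.permCongr π ^ k = e.permCongr (π ^ k) from (map_zpow e.permCongrHom π k).symm]
  simp

theorem isFullCycle_permCongr (e : ι ≃ κ) (π : Perm ι) :
    IsFullCycle (e.permCongr π) ↔ IsFullCycle π := by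
  simp only [IsFullCycle, e.surjective.forall, sameCycle_permCongr]

theorem isFullCycle_finRotate : ∀ n, IsFullCycle (finRotate n)
  | 0 => fun i => i.elim0
  | n + 1 => by
    refine .of_sameCycle 0 fun j => ?_
    induction j using Fin.induction with
    | zero => exact Perm.SameCycle.refl _ _
    | succ j ih =>
      rw [← Fin.coeSucc_eq_succ, ← finRotate_apply]
      exact Perm.sameCycle_apply_right.2 ih

end FullCycles

section Join

variable {ι κ : Type*} [DecidableEq ι] [DecidableEq κ]

/-- The join of two permutations at `a` and `b`: the arrows into `a` and `b` are exchanged, which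
merges the cycle through `a` with the cycle through `b`. -/
def joinPerm (a : ι) (b : κ) (π : Perm ι × Perm κ) : Perm (ι ⊕ κ) :=
  swap (Sum.inl a) (Sum.inr b) * Perm.sumCongr π.1 π.2

theorem joinPerm_inl (a : ι) (b : κ) (π : Perm ι × Perm κ) (i : ι) :
    joinPerm a b π (Sum.inl i) = if π.1 i = a then Sum.inr b else Sum.inl (π.1 i) := by
  simp [joinPerm, swap_apply_def]

theorem joinPerm_inr (a : ι) (b : κ) (π : Perm ι × Perm κ) (i : κ) :
    joinPerm a b π (Sum.inr i) = if π.2 i = b then Sum.inl a else Sum.inr (π.2 i) := by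
  simp [joinPerm, swap_apply_def]

theorem joinPerm_injective (a : ι) (b : κ) : Function.Injective (joinPerm a b) :=
  (mul_right_injective _).comp Perm.sumCongrHom_injective

theorem permCongr_sumComm_joinPerm (a : ι) (b : κ) (π : Perm ι × Perm κ) :
    (sumComm ι κ).permCongr (joinPerm a b π) = joinPerm b a π.swap := by
  ext (i | i)
  · simp only [permCongr_apply, sumComm_symm, sumComm_apply, Sum.swap_inl, joinPerm_inr,
      joinPerm_inl, Prod.fst_swap, apply_ite Sum.swap, Sum.swap_inr]
  · simp only [permCongr_apply, sumComm_symm, sumComm_apply, Sum.swap_inr, joinPerm_inr,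
      joinPerm_inl, Prod.snd_swap, apply_ite Sum.swap, Sum.swap_inl]

theorem IsFullCycle.fst_of_joinPerm [Finite ι] [Finite κ] {a : ι} {b : κ}
    {π : Perm ι × Perm κ} (h : IsFullCycle (joinPerm a b π)) : IsFullCycle π.1 := by
  refine .of_sameCycle a fun j => ?_
  refine h.mem_of_mapsTo (S := {x | π.1.SameCycle a (Sum.elim id (fun _ => a) x)})
    (i := Sum.inl a) ?_ (Perm.SameCycle.refl _ _) (Sum.inl j)
  rintro (i | i) (hi : π.1.SameCycle a _)
  · rw [joinPerm_inl]
    split_ifs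
    exacts [Perm.SameCycle.refl _ _, Perm.sameCycle_apply_right.2 hi]
  · rw [joinPerm_inr]
    split_ifs <;> exact Perm.SameCycle.refl _ _

theorem sameCycle_joinPerm_inl [Finite ι] (a : ι) (b : κ) {π : Perm ι × Perm κ}
    (h : IsFullCycle π.1) (i : ι) : (joinPerm a b π).SameCycle (Sum.inl a) (Sum.inl i) := by
  refine h.mem_of_mapsTo (S := {i | (joinPerm a b π).SameCycle (Sum.inl a) (Sum.inl i)})
    (fun i hi => ?_) (Perm.SameCycle.refl _ _) i
  have hi' := Perm.sameCycle_apply_right.2 hi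
  rw [joinPerm_inl] at hi'
  split_ifs at hi' with hia
  · exact hia ▸ Perm.SameCycle.refl _ _
  · exact hi'

theorem sameCycle_joinPerm_inl_inr [Finite ι] (a : ι) (b : κ) {π : Perm ι × Perm κ}
    (h : IsFullCycle π.1) : (joinPerm a b π).SameCycle (Sum.inl a) (Sum.inr b) := by
  have hb := Perm.sameCycle_apply_right.2 (sameCycle_joinPerm_inl a b h (π.1⁻¹ a))
  rwa [joinPerm_inl, if_pos (by simp)] at hb

theorem isFullCycle_joinPerm [Finite ι] [Finite κ] (a : ι) (b : κ) (π : Perm ι × Perm κ) :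
    IsFullCycle (joinPerm a b π) ↔ IsFullCycle π.1 ∧ IsFullCycle π.2 := by
  have hswap := permCongr_sumComm_joinPerm a b π
  refine ⟨fun h => ⟨h.fst_of_joinPerm, ?_⟩, fun ⟨h₁, h₂⟩ => .of_sameCycle (Sum.inl a) ?_⟩
  · have h' : IsFullCycle (joinPerm b a π.swap) := hswap ▸ (isFullCycle_permCongr _ _).2 h
    exact h'.fst_of_joinPerm
  · rintro (i | i)
    · exact sameCycle_joinPerm_inl a b h₁ i
    · refine (sameCycle_joinPerm_inl_inr a b h₁).trans ?_
      rw [← sameCycle_permCongr (sumComm ι κ), hswap]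
      exact sameCycle_joinPerm_inl b a h₂ i

end Join

section ForwardBackward

variable {V : Type*}

/-- The permutation `(0, v) ↦ (1, v) ↦ (2, v) ↦ (0, π v)`. -/
def forwardPerm (π : Perm V) : Perm (Fin 3 × V) where
  toFun
    | (0, v) => (1, v)
    | (1, v) => (2, v)
    | (2, v) => (0, π v)
  invFun
    | (0, v) => (2, π⁻¹ v)
    | (1, v) => (0, v)
    | (2, v) => (1, v)
  left_inv := by rintro ⟨i, v⟩; fin_cases i <;> simp
  right_inv := by rintro ⟨i, v⟩; fin_cases i <;> simp

/-- The reversal `(i, v) ↦ (2 - i, v)`. -/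
def levelRev : Fin 3 × V ≃ Fin 3 × V := prodCongr Fin.revPerm (Equiv.refl V)

/-- The permutation `(2, v) ↦ (1, v) ↦ (0, v) ↦ (2, π v)`. -/
def backwardPerm (π : Perm V) : Perm (Fin 3 × V) := levelRev.permCongr (forwardPerm π)

theorem levelRev_symm : (levelRev : Fin 3 × V ≃ Fin 3 × V).symm = levelRev := rfl

theorem levelRev_levelRev (x : Fin 3 × V) : levelRev (levelRev x) = x :=
  levelRev.symm_apply_apply x

theorem forwardPerm_injective : Function.Injective (forwardPerm (V := V)) := fun π ρ h =>
  Equiv.ext fun v => by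
    simpa [forwardPerm] using DFunLike.congr_fun h (2, v)

theorem backwardPerm_injective : Function.Injective (backwardPerm (V := V)) :=
  levelRev.permCongr.injective.comp forwardPerm_injective

theorem forwardPerm_ne_backwardPerm [Nonempty V] (π ρ : Perm V) :
    forwardPerm π ≠ backwardPerm ρ := fun h => by
  obtain ⟨v⟩ := ‹Nonempty V›
  have hforward : forwardPerm π (1, v) = (2, v) := rfl
  have hbackward : backwardPerm ρ (1, v) = (0, v) := rfl
  simp [h, hbackward] at hforward

theorem IsFullCycle.of_forwardPerm [Finite V] {π : Perm V} (h : IsFullCycle (forwardPerm π)) :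
    IsFullCycle π := fun v w => by
  refine h.mem_of_mapsTo (S := {x | π.SameCycle v x.2}) (i := (0, v)) ?_
    (Perm.SameCycle.refl _ _) (0, w)
  rintro ⟨i, u⟩ (hu : π.SameCycle v u)
  fin_cases i
  exacts [hu, hu, Perm.sameCycle_apply_right.2 hu]

theorem IsFullCycle.forwardPerm [Finite V] {π : Perm V} (h : IsFullCycle π) :
    IsFullCycle (forwardPerm π) := by
  set σ := AlgRed.forwardPerm π
  have h₁ (v : V) : σ.SameCycle (0, v) (1, v) := ⟨1, rfl⟩
  have h₂ (v : V) : σ.SameCycle (0, v) (2, v) := ⟨2, rfl⟩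
  have h₃ (v : V) : σ.SameCycle (0, v) (0, π v) := ⟨3, rfl⟩
  have h₀ (v w : V) : σ.SameCycle (0, v) (0, w) :=
    h.mem_of_mapsTo (S := {w | σ.SameCycle (0, v) (0, w)}) (fun u hu => hu.trans (h₃ u))
      (Perm.SameCycle.refl _ _) w
  rintro ⟨i, v⟩ y
  refine IsFullCycle.of_sameCycle (0, v) ?_ _ y
  rintro ⟨j, w⟩
  fin_cases j
  exacts [h₀ v w, (h₀ v w).trans (h₁ w), (h₀ v w).trans (h₂ w)]

theorem isFullCycle_forwardPerm [Finite V] (π : Perm V) :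
    IsFullCycle (forwardPerm π) ↔ IsFullCycle π :=
  ⟨.of_forwardPerm, .forwardPerm⟩

theorem isFullCycle_backwardPerm [Finite V] (π : Perm V) :
    IsFullCycle (backwardPerm π) ↔ IsFullCycle π := by
  rw [backwardPerm, isFullCycle_permCongr, isFullCycle_forwardPerm]

end ForwardBackward

section HamiltonianSums

variable {ι κ R : Type*} [Fintype ι] [DecidableEq ι] [Fintype κ] [DecidableEq κ] [CommSemiring R]

open Classical in
/-- The Hamiltonian cycle polynomial evaluated at a matrix, over an arbitrary index type. -/
noncomputable def hamSum (M : Matrix ι ι R) : R :=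
  ∑ π : Perm ι with IsFullCycle π, ∏ i, M i (π i)

theorem hamSum_submatrix (e : κ ≃ ι) (M : Matrix ι ι R) : hamSum (M.submatrix e e) = hamSum M := by
  classical
  refine Finset.sum_equiv e.permCongr (fun π => ?_) fun π _ => ?_
  · simp [isFullCycle_permCongr]
  · exact Fintype.prod_equiv e _ _ fun i => by simp

open Classical in
theorem hamSum_eq_sum_of_injective {α : Type*} [Fintype α] {M : Matrix ι ι R} {f : α → Perm ι}
    (hf : Function.Injective f)
    (hM : ∀ σ : Perm ι, IsFullCycle σ → (∀ i, M i (σ i) ≠ 0) → σ ∈ Set.range f) :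
    hamSum M = ∑ a with IsFullCycle (f a), ∏ i, M i (f a i) := by
  refine (Finset.sum_of_injOn f hf.injOn (fun a ha => ?_) (fun σ hσ hσf => ?_) fun _ _ => rfl).symm
  · simpa using ha
  · by_contra hne
    have hfull : IsFullCycle σ := by simpa using hσ
    obtain ⟨a, rfl⟩ := hM σ hfull fun i hi => hne (Finset.prod_eq_zero (Finset.mem_univ i) hi)
    exact hσf ⟨a, by simpa using hfull, rfl⟩

theorem hamSum_weighted_perm {c : Perm ι} (hc : IsFullCycle c) (w : ι → R) :
    hamSum (Matrix.of fun i j => if j = c i then w i else 0) = ∏ i, w i := by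
  classical
  rw [hamSum_eq_sum_of_injective (f := fun _ : Unit => c) (Function.injective_of_subsingleton _)]
  · simp [hc]
  · intro σ _ hσ
    have hσc (i : ι) : σ i = c i := by simpa using fun h : σ i ≠ c i => hσ i (if_neg h)
    exact ⟨(), (Equiv.ext hσc).symm⟩

end HamiltonianSums

section JoinMatrix

variable {ι κ R : Type*} [DecidableEq ι] [DecidableEq κ] [CommSemiring R]

/-- The block diagonal matrix of `M` and `N` with its columns `a` and `b` exchanged, so that its
Hamiltonian cycles are the joins at `a` and `b` of those of `M` and `N`. -/
def joinMatrix (a : ι) (b : κ) (M : Matrix ι ι R) (N : Matrix κ κ R) : Matrix (ι ⊕ κ) (ι ⊕ κ) R :=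
  (Matrix.fromBlocks M 0 0 N).submatrix id (swap (Sum.inl a) (Sum.inr b))

theorem mem_range_joinPerm [Finite ι] [Finite κ] {a : ι} {b : κ} {M : Matrix ι ι R}
    {N : Matrix κ κ R} {σ : Perm (ι ⊕ κ)} (hσ : ∀ x, joinMatrix a b M N x (σ x) ≠ 0) :
    σ ∈ Set.range (joinPerm a b) := by
  set τ := swap (Sum.inl a) (Sum.inr b) * σ with hτ
  have hmaps : Set.MapsTo τ (Set.range Sum.inl) (Set.range Sum.inl) := by
    rintro _ ⟨i, rfl⟩
    have hi : Matrix.fromBlocks M 0 0 N (Sum.inl i) (τ (Sum.inl i)) ≠ 0 := hσ (Sum.inl i)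
    rcases hτi : τ (Sum.inl i) with j | j
    · exact ⟨j, rfl⟩
    · exact absurd (by rw [hτi]; rfl) hi
  obtain ⟨π, hπ : Perm.sumCongr π.1 π.2 = τ⟩ := Perm.mem_sumCongrHom_range_of_perm_mapsTo_inl hmaps
  exact ⟨π, by rw [joinPerm, hπ, hτ, swap_mul_self_mul]⟩

theorem hamSum_joinMatrix [Fintype ι] [Fintype κ] (a : ι) (b : κ) (M : Matrix ι ι R)
    (N : Matrix κ κ R) : hamSum (joinMatrix a b M N) = hamSum M * hamSum N := by
  classical
  rw [hamSum_eq_sum_of_injective (joinPerm_injective a b) fun σ _ => mem_range_joinPerm]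
  simp_rw [isFullCycle_joinPerm, ← Finset.univ_product_univ, Finset.filter_product]
  rw [hamSum, hamSum, Finset.sum_mul_sum, ← Finset.sum_product']
  refine Finset.sum_congr rfl fun π _ => ?_
  simp [Fintype.prod_sum_type, joinMatrix, joinPerm]

end JoinMatrix

section SumMatrix

variable {V R : Type*} [DecidableEq V] [CommSemiring R]

/-- The matrix in which every vertex `v` is replaced by a two-way path
`(0, v) ↔ (1, v) ↔ (2, v)`; the arrows `(2, v) → (0, w)` carry the weights of `A`, the arrows
`(0, v) → (2, w)` those of `B`. Its Hamiltonian cycles traverse either all paths forwards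
or all paths backwards. -/
def sumMatrix (A B : Matrix V V R) : Matrix (Fin 3 × V) (Fin 3 × V) R
  | (0, v), (1, w) | (1, v), (0, w) | (1, v), (2, w) | (2, v), (1, w) => if w = v then 1 else 0
  | (2, v), (0, w) => A v w
  | (0, v), (2, w) => B v w
  | (0, _), (0, _) | (1, _), (1, _) | (2, _), (2, _) => 0

theorem sumMatrix_submatrix_levelRev (A B : Matrix V V R) :
    (sumMatrix A B).submatrix levelRev levelRev = sumMatrix B A := by
  ext ⟨i, v⟩ ⟨j, w⟩
  fin_cases i <;> fin_cases j <;> rfl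

section Support

variable {A B : Matrix V V R} {σ : Perm (Fin 3 × V)}

theorem eq_of_sumMatrix_one_ne_zero {v : V} {y : Fin 3 × V} (h : sumMatrix A B (1, v) y ≠ 0) :
    y = (0, v) ∨ y = (2, v) := by
  obtain ⟨j, w⟩ := y
  fin_cases j <;> simp_all [sumMatrix]

theorem eq_of_sumMatrix_to_one_ne_zero {v : V} {x : Fin 3 × V}
    (h : sumMatrix A B x (1, v) ≠ 0) : x = (0, v) ∨ x = (2, v) := by
  obtain ⟨i, w⟩ := x
  fin_cases i <;> simp_all [sumMatrix]

theorem eq_or_of_sumMatrix_two_ne_zero {v : V} {y : Fin 3 × V} (h : sumMatrix A B (2, v) y ≠ 0) :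
    y = (1, v) ∨ ∃ w, y = (0, w) := by
  obtain ⟨j, w⟩ := y
  fin_cases j <;> simp_all [sumMatrix]

theorem forwards_or_backwards [Finite V] (hσ : IsFullCycle σ)
    (hsupp : ∀ x, sumMatrix A B x (σ x) ≠ 0) (v : V) :
    σ (0, v) = (1, v) ∧ σ (1, v) = (2, v) ∨ σ (2, v) = (1, v) ∧ σ (1, v) = (0, v) := by
  obtain ⟨x, hx⟩ := σ.surjective (1, v)
  rcases eq_of_sumMatrix_to_one_ne_zero (hx ▸ hsupp x) with rfl | rfl <;>
    rcases eq_of_sumMatrix_one_ne_zero (hsupp (1, v)) with hout | hout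
  · simpa using hσ.eq_or_eq_of_two_cycle hx hout (2, v)
  · exact Or.inl ⟨hx, hout⟩
  · exact Or.inr ⟨hx, hout⟩
  · simpa using hσ.eq_or_eq_of_two_cycle hx hout (0, v)

theorem forall_forwards [Finite V] (hσ : IsFullCycle σ)
    (hsupp : ∀ x, sumMatrix A B x (σ x) ≠ 0) {v : V}
    (hv : σ (0, v) = (1, v) ∧ σ (1, v) = (2, v)) (w : V) :
    σ (0, w) = (1, w) ∧ σ (1, w) = (2, w) ∧ ∃ u, σ (2, w) = (0, u) := by
  have hnext {w : V} (hw : σ (0, w) = (1, w)) : ∃ u, σ (2, w) = (0, u) :=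
    (eq_or_of_sumMatrix_two_ne_zero (hsupp (2, w))).resolve_left fun h => by
      simpa using σ.injective (h.trans hw.symm)
  suffices hw : σ (0, w) = (1, w) ∧ σ (1, w) = (2, w) from ⟨hw.1, hw.2, hnext hw.1⟩
  refine hσ.mem_of_mapsTo (S := {x | σ (0, x.2) = (1, x.2) ∧ σ (1, x.2) = (2, x.2)})
    (i := (0, v)) ?_ hv (0, w)
  rintro ⟨i, u⟩ (hu : σ (0, u) = (1, u) ∧ σ (1, u) = (2, u))
  fin_cases i
  · simpa [hu.1] using hu
  · simpa [hu.2] using hu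
  · obtain ⟨u', hu'⟩ := hnext hu.1
    have hforwards := (forwards_or_backwards hσ hsupp u').resolve_right fun h => by
      simpa using σ.injective (h.2.trans hu'.symm)
    simpa [hu'] using hforwards

theorem mem_range_forwardPerm [Finite V] (hσ : IsFullCycle σ)
    (hsupp : ∀ x, sumMatrix A B x (σ x) ≠ 0) {v : V}
    (hv : σ (0, v) = (1, v) ∧ σ (1, v) = (2, v)) : σ ∈ Set.range (forwardPerm (V := V)) := by
  choose h₀ h₁ π h₂ using forall_forwards hσ hsupp hv
  have hπ : Function.Injective π := fun u w huw => by
    have hσuw : σ (2, u) = σ (2, w) := by rw [h₂, h₂, huw]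
    simpa using σ.injective hσuw
  refine ⟨Equiv.ofBijective π (Finite.injective_iff_bijective.1 hπ), Equiv.ext ?_⟩
  rintro ⟨i, w⟩
  fin_cases i
  exacts [(h₀ w).symm, (h₁ w).symm, (h₂ w).symm]

theorem mem_range_forwardPerm_or_backwardPerm [Finite V] [Nonempty V] (hσ : IsFullCycle σ)
    (hsupp : ∀ x, sumMatrix A B x (σ x) ≠ 0) :
    σ ∈ Set.range (Sum.elim (forwardPerm (V := V)) backwardPerm) := by
  obtain ⟨v⟩ := ‹Nonempty V›
  rcases forwards_or_backwards hσ hsupp v with hv | hv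
  · obtain ⟨π, hπ⟩ := mem_range_forwardPerm hσ hsupp hv
    exact ⟨Sum.inl π, hπ⟩
  · have hsupp' (x) : sumMatrix B A x (levelRev.permCongr σ x) ≠ 0 := by
      rw [← sumMatrix_submatrix_levelRev]
      simpa [levelRev_symm, levelRev_levelRev] using hsupp (levelRev x)
    obtain ⟨π, hπ⟩ := mem_range_forwardPerm (v := v) ((isFullCycle_permCongr _ _).2 hσ) hsupp'
      ⟨congrArg levelRev hv.1, congrArg levelRev hv.2⟩
    refine ⟨Sum.inr π, ?_⟩
    rw [Sum.elim_inr, backwardPerm, hπ]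
    ext x : 1
    simp [levelRev_symm, levelRev_levelRev]

end Support

variable [Fintype V]

theorem prod_sumMatrix_forwardPerm (A B : Matrix V V R) (π : Perm V) :
    ∏ x, sumMatrix A B x (forwardPerm π x) = ∏ v, A v (π v) := by
  simp [Fintype.prod_prod_type, Fin.prod_univ_three, forwardPerm, sumMatrix]

theorem prod_sumMatrix_backwardPerm (A B : Matrix V V R) (π : Perm V) :
    ∏ x, sumMatrix A B x (backwardPerm π x) = ∏ v, B v (π v) := by
  rw [← prod_sumMatrix_forwardPerm B A, ← sumMatrix_submatrix_levelRev, ← Equiv.prod_comp levelRev]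
  simp [backwardPerm, levelRev_symm, levelRev_levelRev]

theorem hamSum_sumMatrix [Nonempty V] (A B : Matrix V V R) :
    hamSum (sumMatrix A B) = hamSum A + hamSum B := by
  classical
  have hinj : Function.Injective (Sum.elim (forwardPerm (V := V)) backwardPerm) :=
    forwardPerm_injective.sumElim backwardPerm_injective forwardPerm_ne_backwardPerm
  rw [hamSum_eq_sum_of_injective hinj fun σ => mem_range_forwardPerm_or_backwardPerm]
  simp [Finset.sum_filter, hamSum, isFullCycle_forwardPerm, isFullCycle_backwardPerm,
    prod_sumMatrix_forwardPerm, prod_sumMatrix_backwardPerm]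

end SumMatrix

section Projections

section Leaf

variable {σ R : Type*} [CommSemiring R]

/-- The polynomials that may be substituted for a variable in a projection: variables and
constants. -/
def IsLeaf (p : MvPolynomial σ R) : Prop := p ∈ Set.range (Sum.elim X C)

theorem isLeaf_X (i : σ) : IsLeaf (X i : MvPolynomial σ R) := ⟨Sum.inl i, rfl⟩

theorem isLeaf_C (c : R) : IsLeaf (C c : MvPolynomial σ R) := ⟨Sum.inr c, rfl⟩

theorem isLeaf_zero : IsLeaf (0 : MvPolynomial σ R) := C_0 (R := R) (σ := σ) ▸ isLeaf_C 0

theorem isLeaf_one : IsLeaf (1 : MvPolynomial σ R) := isLeaf_C 1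

theorem IsLeaf.map {S : Type*} [CommSemiring S] (φ : R →+* S) {p : MvPolynomial σ R}
    (hp : IsLeaf p) : IsLeaf (MvPolynomial.map φ p) := by
  obtain ⟨i | c, rfl⟩ := hp
  · simpa using isLeaf_X i
  · simpa using isLeaf_C (φ c)

theorem IsLeaf.rename {τ : Type*} (e : σ → τ) {p : MvPolynomial σ R} (hp : IsLeaf p) :
    IsLeaf (MvPolynomial.rename e p) := by
  obtain ⟨i | c, rfl⟩ := hp
  · simpa using isLeaf_X (e i)
  · simpa using isLeaf_C c

end Leaf

variable {K : Type*} [Field K] {N M : ℕ} {f : MvPolynomial (Fin N) K} {g : MvPolynomial (Fin M) K}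

theorem isProjection_iff : IsProjection f g ↔
    ∃ v : Fin M → MvPolynomial (Fin N) K, (∀ i, IsLeaf (v i)) ∧ f = aeval v g := by
  refine ⟨fun ⟨α, h⟩ => ⟨_, fun i => ⟨α i, rfl⟩, h⟩, fun ⟨v, hv, h⟩ => ?_⟩
  choose α hα using hv
  exact ⟨α, by simpa only [hα] using h⟩

theorem isProjection_refl (f : MvPolynomial (Fin N) K) : IsProjection f f :=
  ⟨Sum.inl, by simp⟩

theorem IsProjection.map {L : Type*} [Field L] (φ : K →+* L) (h : IsProjection f g) :
    IsProjection (MvPolynomial.map φ f) (MvPolynomial.map φ g) := by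
  obtain ⟨v, hv, rfl⟩ := isProjection_iff.1 h
  refine isProjection_iff.2 ⟨_, fun i => (hv i).map φ, ?_⟩
  rw [aeval_eq_bind₁, aeval_eq_bind₁, map_bind₁]

theorem IsProjection.rename {N' : ℕ} (e : Fin N → Fin N') (h : IsProjection f g) :
    IsProjection (MvPolynomial.rename e f) g := by
  obtain ⟨v, hv, rfl⟩ := isProjection_iff.1 h
  exact isProjection_iff.2 ⟨_, fun i => (hv i).rename e, (comp_aeval_apply _ _ _)⟩

theorem IsProjection.pow (h : IsProjection f g) (k : ℕ) : IsProjection (f ^ k) (g ^ k) := by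
  obtain ⟨α, rfl⟩ := h
  exact ⟨α, (map_pow _ _ _).symm⟩

end Projections

section HamiltonianProjections

variable {K : Type*} [Field K] {N m n : ℕ} {f g p : MvPolynomial (Fin N) K}

theorem aeval_hcPoly {A : Type*} [CommSemiring A] [Algebra K A] (n : ℕ) (v : Fin (n * n) → A) :
    aeval v (hcPoly K n) = hamSum (Matrix.of fun i j => v (finProdFinEquiv (i, j))) := by
  classical
  simp only [hcPoly, hamSum, map_sum, map_prod, aeval_X, Matrix.of_apply]
  refine Finset.sum_congr ?_ fun _ _ => rfl
  ext π
  rw [fullCycles, Finset.mem_filter, Finset.mem_filter]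
  rfl

theorem isProjection_hamSum {ι : Type*} [Fintype ι] [DecidableEq ι] (hι : Fintype.card ι = m)
    {A : Matrix ι ι (MvPolynomial (Fin N) K)} (hA : ∀ i j, IsLeaf (A i j)) :
    IsProjection (hamSum A) (hcPoly K m) := by
  let e : Fin m ≃ ι := (Fintype.equivFinOfCardEq hι).symm
  refine isProjection_iff.2 ⟨fun k => A (e (finProdFinEquiv.symm k).1)
    (e (finProdFinEquiv.symm k).2), fun k => hA _ _, ?_⟩
  rw [aeval_hcPoly, ← hamSum_submatrix e]
  simp [Matrix.submatrix]

theorem isProjection_hcPoly_iff : IsProjection f (hcPoly K m) ↔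
    ∃ A : Matrix (Fin m) (Fin m) (MvPolynomial (Fin N) K),
      (∀ i j, IsLeaf (A i j)) ∧ hamSum A = f := by
  constructor
  · rw [isProjection_iff]
    rintro ⟨v, hv, rfl⟩
    exact ⟨_, fun i j => hv _, (aeval_hcPoly m v).symm⟩
  · rintro ⟨A, hA, rfl⟩
    exact isProjection_hamSum (Fintype.card_fin m) hA

theorem isProjection_prod_hcPoly {w : Fin m → MvPolynomial (Fin N) K} (hw : ∀ i, IsLeaf (w i)) :
    IsProjection (∏ i, w i) (hcPoly K m) := by
  rw [← hamSum_weighted_perm (isFullCycle_finRotate m) w]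
  refine isProjection_hamSum (Fintype.card_fin m) fun i j => ?_
  rw [Matrix.of_apply]
  split_ifs
  exacts [hw i, isLeaf_zero]

theorem isProjection_one_hcPoly : IsProjection (1 : MvPolynomial (Fin N) K) (hcPoly K m) := by
  simpa using isProjection_prod_hcPoly fun _ : Fin m => isLeaf_one (σ := Fin N) (R := K)

theorem IsLeaf.isProjection_hcPoly_one (hp : IsLeaf p) : IsProjection p (hcPoly K 1) := by
  simpa using isProjection_prod_hcPoly fun _ : Fin 1 => hp

theorem IsProjection.eq_one_of_hcPoly_zero (hf : IsProjection f (hcPoly K 0)) : f = 1 := by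
  obtain ⟨A, -, rfl⟩ := isProjection_hcPoly_iff.1 hf
  simp [hamSum, IsFullCycle]

theorem IsProjection.mul_hcPoly (hf : IsProjection f (hcPoly K m))
    (hg : IsProjection g (hcPoly K n)) : IsProjection (f * g) (hcPoly K (m + n)) := by
  rcases m with - | m
  · rwa [hf.eq_one_of_hcPoly_zero, one_mul, Nat.zero_add]
  rcases n with - | n
  · simpa [hg.eq_one_of_hcPoly_zero] using hf
  obtain ⟨A, hA, rfl⟩ := isProjection_hcPoly_iff.1 hf
  obtain ⟨B, hB, rfl⟩ := isProjection_hcPoly_iff.1 hg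
  rw [← hamSum_joinMatrix 0 0]
  refine isProjection_hamSum (by simp) fun i j => ?_
  rw [joinMatrix, Matrix.submatrix_apply]
  rcases i with i | i <;> rcases swap _ _ j with j | j
  exacts [hA _ _, isLeaf_zero, isLeaf_zero, hB _ _]

theorem IsProjection.add_hcPoly (hm : 0 < m) (hf : IsProjection f (hcPoly K m))
    (hg : IsProjection g (hcPoly K m)) : IsProjection (f + g) (hcPoly K (3 * m)) := by
  have := Fin.pos_iff_nonempty.1 hm
  obtain ⟨A, hA, rfl⟩ := isProjection_hcPoly_iff.1 hf
  obtain ⟨B, hB, rfl⟩ := isProjection_hcPoly_iff.1 hg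
  rw [← hamSum_sumMatrix]
  refine isProjection_hamSum (by simp) ?_
  have hite (v w : Fin m) : IsLeaf (if w = v then (1 : MvPolynomial (Fin N) K) else 0) := by
    split_ifs
    exacts [isLeaf_one, isLeaf_zero]
  rintro ⟨i, v⟩ ⟨j, w⟩
  fin_cases i <;> fin_cases j
  exacts [isLeaf_zero, hite _ _, hB _ _, hite _ _, isLeaf_zero, hite _ _, hA _ _, hite _ _,
    isLeaf_zero]

theorem IsLeaf.isProjection_one_add_mul (hp : IsLeaf p) (hf : IsProjection f (hcPoly K n)) :
    IsProjection (1 + p * f) (hcPoly K (3 * (1 + n))) :=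
  .add_hcPoly (by omega) isProjection_one_hcPoly (hp.isProjection_hcPoly_one.mul_hcPoly hf)

end HamiltonianProjections

section BorderPad

variable {R : Type*} [CommSemiring R] {N : ℕ}

/-- The polynomial `z² (y f + y² f²)`, where `y` and `z` are two new variables. It degenerates to
`f`, and `(P)` is obtained by applying it to `(HC)`. -/
noncomputable def borderPad (f : MvPolynomial (Fin N) R) : MvPolynomial (Fin (N + 2)) R :=
  X (Fin.natAdd N 1) ^ 2 * (X (Fin.natAdd N 0) * rename (Fin.castAdd 2) f +
    X (Fin.natAdd N 0) ^ 2 * rename (Fin.castAdd 2) f ^ 2)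

theorem map_borderPad {S : Type*} [CommSemiring S] (φ : R →+* S) (f : MvPolynomial (Fin N) R) :
    map φ (borderPad f) = borderPad (map φ f) := by
  simp [borderPad, map_rename]

theorem aeval_borderPad {A : Type*} [CommSemiring A] [Algebra R A] (v : Fin (N + 2) → A)
    (f : MvPolynomial (Fin N) R) :
    aeval v (borderPad f) = v (Fin.natAdd N 1) ^ 2 *
      (v (Fin.natAdd N 0) * aeval (v ∘ Fin.castAdd 2) f +
        v (Fin.natAdd N 0) ^ 2 * aeval (v ∘ Fin.castAdd 2) f ^ 2) := by
  simp [borderPad, aeval_rename]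

theorem totalDegree_borderPad_le (f : MvPolynomial (Fin N) R) :
    (borderPad f).totalDegree ≤ 4 + 2 * f.totalDegree := by
  have hf := totalDegree_rename_le (Fin.castAdd 2) f
  have hf_sq := totalDegree_pow (rename (Fin.castAdd 2) f) 2
  have hX (i : Fin (N + 2)) : (X i : MvPolynomial _ R).totalDegree ≤ 1 :=
    (isHomogeneous_X R i).totalDegree_le
  have hX_sq (i : Fin (N + 2)) : (X i ^ 2 : MvPolynomial _ R).totalDegree ≤ 2 :=
    (isHomogeneous_X_pow i 2).totalDegree_le
  refine (totalDegree_mul _ _).trans ?_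
  grw [totalDegree_add, totalDegree_mul, totalDegree_mul, hX, hX_sq, hX_sq, hf_sq, hf]
  omega

theorem isProjection_borderPad {K : Type*} [Field K] {f : MvPolynomial (Fin N) K} {m : ℕ}
    (hf : IsProjection f (hcPoly K m)) :
    IsProjection (borderPad f) (hcPoly K (3 + m + 3 * (1 + m))) := by
  have hf' := hf.rename (Fin.castAdd 2)
  let y : MvPolynomial (Fin (N + 2)) K := X (Fin.natAdd N 0)
  let z : MvPolynomial (Fin (N + 2)) K := X (Fin.natAdd N 1)
  have hy : IsLeaf y := isLeaf_X _
  have hzzy : IsProjection (∏ i, ![z, z, y] i) (hcPoly K 3) :=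
    isProjection_prod_hcPoly (by simp [Fin.forall_fin_succ, hy, z, isLeaf_X])
  convert (hzzy.mul_hcPoly hf').mul_hcPoly (hy.isProjection_one_add_mul hf') using 1
  simp only [borderPad, Fin.prod_univ_three, Matrix.cons_val]
  ring

end BorderPad

section PolyBounded

theorem polynomial_eval_nat_mono (p : Polynomial ℕ) : Monotone fun n => p.eval n := fun a b h => by
  simp only [Polynomial.eval_eq_sum]
  exact Finset.sum_le_sum fun i _ => Nat.mul_le_mul_left _ (Nat.pow_le_pow_left h i)

theorem PolyBounded.mono {s t : ℕ → ℕ} (ht : PolyBounded t) (h : ∀ n, s n ≤ t n) :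
    PolyBounded s := by
  obtain ⟨p, hp⟩ := ht
  exact ⟨p, fun n => (h n).trans (hp n)⟩

theorem PolyBounded.comp {s t : ℕ → ℕ} (hs : PolyBounded s) (ht : PolyBounded t) :
    PolyBounded fun n => s (t n) := by
  obtain ⟨p, hp⟩ := hs
  obtain ⟨q, hq⟩ := ht
  refine ⟨p.comp q, fun n => ?_⟩
  rw [Polynomial.eval_comp]
  exact (hp _).trans (polynomial_eval_nat_mono p (hq n))

theorem PolyBounded.add_one {t : ℕ → ℕ} (ht : PolyBounded t) : PolyBounded fun n => t n + 1 := by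
  obtain ⟨p, hp⟩ := ht
  exact ⟨p + 1, fun n => by simpa using hp n⟩

end PolyBounded

section VNP

variable (F : Type*) [Field F]

theorem totalDegree_hcPoly_le (n : ℕ) : (hcPoly F n).totalDegree ≤ n := by
  refine totalDegree_finsetSum_le fun π _ => ?_
  refine (totalDegree_finsetProd _ _).trans ?_
  simp

theorem HCsq_mem_VNP : HCsq F ∈ VNP F := by
  refine ⟨⟨⟨.X * .X, fun n => by simp [HCsq]⟩, ⟨2 * .X, fun n => ?_⟩⟩,
    fun n => n + n, ⟨.X + .X, by simp⟩, fun n => ?_⟩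
  · rw [Polynomial.eval_mul, Polynomial.eval_ofNat, Polynomial.eval_X]
    exact (totalDegree_pow (hcPoly F n) 2).trans
      (Nat.mul_le_mul_left 2 (totalDegree_hcPoly_le F n))
  · have hself := isProjection_refl (hcPoly F n)
    have hsq : IsProjection (hcPoly F n ^ 2) (hcPoly F (n + n)) := by
      simpa only [sq] using hself.mul_hcPoly hself
    exact hsq

theorem PFam_mem_VNP : PFam F ∈ VNP F := by
  refine ⟨⟨⟨.X * .X + 2, fun n => by simp [PFam]⟩, ⟨4 + 2 * .X, fun n => ?_⟩⟩,
    fun n => 3 + n + 3 * (1 + n), ⟨3 + .X + 3 * (1 + .X), by simp⟩,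
    fun n => isProjection_borderPad (isProjection_refl (hcPoly F n))⟩
  simp only [Polynomial.eval_add, Polynomial.eval_mul, Polynomial.eval_ofNat, Polynomial.eval_X]
  exact (totalDegree_borderPad_le (hcPoly F n)).trans
    (Nat.add_le_add_left (Nat.mul_le_mul_left 2 (totalDegree_hcPoly_le F n)) 4)

end VNP

section Circuits

variable {K L : Type*} [Field K] [Field L] {N M s : ℕ}

/-- Some circuit with `s` nodes and `g`-oracle gates computes all polynomials in `S`. Unlike the
complexity of a single polynomial, this notion can be extended gate by gate. -/
def JointlyComputable (g : MvPolynomial (Fin M) K) (S : Set (MvPolynomial (Fin N) K)) (s : ℕ) :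
    Prop :=
  ∃ c : Circuit K N M s, S ⊆ Set.range (c.values g)

section JointlyComputable

variable {g : MvPolynomial (Fin M) K} {S T : Set (MvPolynomial (Fin N) K)}
  {f p q : MvPolynomial (Fin N) K}

theorem jointlyComputable_empty (g : MvPolynomial (Fin M) K) :
    JointlyComputable g (∅ : Set (MvPolynomial (Fin N) K)) 0 :=
  ⟨.empty, Set.empty_subset _⟩

theorem JointlyComputable.oracleComplexity_le (h : JointlyComputable g S s) (hf : f ∈ S) :
    oracleComplexity g f ≤ s := by
  obtain ⟨c, hc⟩ := h
  exact Nat.sInf_le ⟨c, hc hf⟩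

theorem JointlyComputable.mono (h : JointlyComputable g S s) (hT : T ⊆ S) :
    JointlyComputable g T s := by
  obtain ⟨c, hc⟩ := h
  exact ⟨c, hT.trans hc⟩

theorem jointlyComputable_snoc {c : Circuit K N M s} (hc : S ⊆ Set.range (c.values g))
    (γ : Gate K N M s) :
    JointlyComputable g (insert (γ.value g (c.values g)) S) (s + 1) := by
  refine ⟨c.snoc γ, Set.insert_subset ⟨Fin.last _, Fin.snoc_last _ _⟩ fun p hp => ?_⟩
  obtain ⟨j, rfl⟩ := hc hp
  exact ⟨j.castSucc, Fin.snoc_castSucc _ _ _⟩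

theorem JointlyComputable.insert_leaf (h : JointlyComputable g S s) (hp : IsLeaf p) :
    JointlyComputable g (insert p S) (s + 1) := by
  obtain ⟨c, hc⟩ := h
  obtain ⟨j | a, rfl⟩ := hp
  exacts [jointlyComputable_snoc hc (.var j), jointlyComputable_snoc hc (.const a)]

theorem JointlyComputable.insert_add (h : JointlyComputable g S s) (hp : p ∈ S) (hq : q ∈ S) :
    JointlyComputable g (insert (p + q) S) (s + 1) := by
  obtain ⟨c, hc⟩ := h
  obtain ⟨i, rfl⟩ := hc hp
  obtain ⟨j, rfl⟩ := hc hq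
  exact jointlyComputable_snoc hc (.add i j)

theorem JointlyComputable.insert_mul (h : JointlyComputable g S s) (hp : p ∈ S) (hq : q ∈ S) :
    JointlyComputable g (insert (p * q) S) (s + 1) := by
  obtain ⟨c, hc⟩ := h
  obtain ⟨i, rfl⟩ := hc hp
  obtain ⟨j, rfl⟩ := hc hq
  exact jointlyComputable_snoc hc (.mul i j)

theorem JointlyComputable.insert_oracle (h : JointlyComputable g S s)
    {v : Fin M → MvPolynomial (Fin N) K} (hv : ∀ i, v i ∈ S) :
    JointlyComputable g (insert (aeval v g) S) (s + 1) := by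
  obtain ⟨c, hc⟩ := h
  choose a ha using fun i => hc (hv i)
  obtain rfl : (fun i => c.values g (a i)) = v := funext ha
  exact jointlyComputable_snoc hc (.oracle a)

theorem JointlyComputable.union_leaves (h : JointlyComputable g S s) {k : ℕ}
    {v : Fin k → MvPolynomial (Fin N) K} (hv : ∀ i, IsLeaf (v i)) :
    JointlyComputable g (Set.range v ∪ S) (s + k) := by
  induction k with
  | zero => exact h.mono (by simp)
  | succ k ih =>
    rw [Fin.range_fin_succ, Set.insert_union]
    exact (ih fun i => hv i.succ).insert_leaf (hv 0)

theorem JointlyComputable.insert_projection (h : JointlyComputable g S s)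
    (hf : IsProjection f g) : JointlyComputable g (insert f S) (s + M + 1) := by
  obtain ⟨v, hv, rfl⟩ := isProjection_iff.1 hf
  exact ((h.union_leaves hv).insert_oracle fun i => Or.inl ⟨i, rfl⟩).mono
    (Set.insert_subset_insert Set.subset_union_right)

theorem JointlyComputable.insert_linearCombination (h : JointlyComputable g S s) (hp : p ∈ S)
    (hq : q ∈ S) (a b : K) : JointlyComputable g (insert (C a * p + C b * q) S) (s + 5) := by
  have hconst := (h.insert_leaf (isLeaf_C a)).insert_leaf (isLeaf_C b)
  have hmul := (hconst.insert_mul (p := C a) (q := p) (by simp) (by simp [hp])).insert_mul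
    (p := C b) (q := q) (by simp) (by simp [hq])
  have hadd := hmul.insert_add (p := C a * p) (q := C b * q) (by simp) (by simp)
  refine hadd.mono (Set.insert_subset_insert ?_)
  simp only [Set.subset_def, Set.mem_insert_iff]
  tauto

theorem oracleComplexity_le_of_isProjection (hf : IsProjection f g) :
    oracleComplexity g f ≤ M + 1 := by
  simpa using ((jointlyComputable_empty g).insert_projection hf).oracleComplexity_le
    (Set.mem_insert f ∅)

theorem oracleComplexity_sq_le (h2 : (2 : K) ≠ 0) (hadd : IsProjection (1 + f) g)
    (hsub : IsProjection (1 - f) g) : oracleComplexity (g ^ 2) f ≤ 2 * M + 7 := by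
  have hsquares := ((jointlyComputable_empty (g ^ 2)).insert_projection
    (hadd.pow 2)).insert_projection (hsub.pow 2)
  have hcomb := hsquares.insert_linearCombination (p := (1 + f) ^ 2) (q := (1 - f) ^ 2)
    (by simp) (by simp) 4⁻¹ (-4⁻¹)
  have hpolar : C (4⁻¹ : K) * (1 + f) ^ 2 + C (-4⁻¹ : K) * (1 - f) ^ 2 = f := by
    have h4 : C (4⁻¹ : K) * 4 = (1 : MvPolynomial (Fin N) K) := by
      rw [← map_ofNat C 4, ← C_mul, inv_mul_cancel₀, C_1]
      rw [show (4 : K) = 2 * 2 by norm_num]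
      exact mul_ne_zero h2 h2
    rw [C_neg]
    linear_combination f * h4
  rw [hpolar] at hcomb
  exact (hcomb.oracleComplexity_le (Set.mem_insert _ _)).trans (by omega)

end JointlyComputable

/-- The gate over `L` that arises from a gate over `K` by mapping its constant. -/
def Gate.map (φ : K → L) : Gate K N M s → Gate L N M s
  | .var j => .var j
  | .const c => .const (φ c)
  | .add a b => .add a b
  | .mul a b => .mul a b
  | .oracle a => .oracle a

/-- Extension of scalars for circuits: it shows that complexities do not increase from `F` to
`F(ε)`. -/
def Circuit.map (φ : K → L) : {s : ℕ} → Circuit K N M s → Circuit L N M s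
  | _, .empty => .empty
  | _, .snoc c γ => .snoc (c.map φ) (γ.map φ)

theorem Gate.value_map (φ : K →+* L) (g : MvPolynomial (Fin M) K)
    (v : Fin s → MvPolynomial (Fin N) K) (γ : Gate K N M s) :
    (γ.map φ).value (MvPolynomial.map φ g) (MvPolynomial.map φ ∘ v) =
      MvPolynomial.map φ (γ.value g v) := by
  cases γ with
  | oracle a => simp only [Gate.map, Gate.value, aeval_eq_bind₁, map_bind₁, Function.comp_apply]
  | _ => simp [Gate.map, Gate.value]

theorem Circuit.values_map (φ : K →+* L) (g : MvPolynomial (Fin M) K) (c : Circuit K N M s) :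
    (c.map φ).values (MvPolynomial.map φ g) = MvPolynomial.map φ ∘ c.values g := by
  induction c with
  | empty => exact funext fun i => i.elim0
  | snoc c γ ih =>
    rw [Circuit.map, Circuit.values, ih, Gate.value_map, Circuit.values, Fin.comp_snoc]

theorem oracleComplexity_map_le (φ : K →+* L) (g : MvPolynomial (Fin M) K)
    (f : MvPolynomial (Fin N) K) :
    oracleComplexity (map φ g) (map φ f) ≤ oracleComplexity g f := by
  obtain ⟨c, root, hroot⟩ : ComputableWithSize g f (oracleComplexity g f) :=
    Nat.sInf_mem (exists_computableWithSize g f)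
  exact Nat.sInf_le ⟨c.map φ, root, by rw [Circuit.values_map, Function.comp_apply, hroot]⟩

end Circuits

section Reductions

variable {F : Type*} [Field F]

section Projections

variable {N M : ℕ} {f : MvPolynomial (Fin N) F} {g : MvPolynomial (Fin M) F}

theorem perturb_zero (f : MvPolynomial (Fin N) F) : perturb f 0 = extend f := by
  simp [perturb]

theorem IsProjection.isBorderProjection (h : IsProjection f g) : IsBorderProjection f g :=
  ⟨0, perturb_zero f ▸ h.map RatFunc.C⟩

theorem borderOracleComplexity_le (g : MvPolynomial (Fin M) F) (f : MvPolynomial (Fin N) F)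
    (h : MvPolynomial (Fin N) (Polynomial F)) :
    borderOracleComplexity g f ≤ oracleComplexity (extend g) (perturb f h) :=
  Nat.sInf_le ⟨h, le_rfl⟩

theorem borderOracleComplexity_le_oracleComplexity (g : MvPolynomial (Fin M) F)
    (f : MvPolynomial (Fin N) F) : borderOracleComplexity g f ≤ oracleComplexity g f := by
  refine (borderOracleComplexity_le g f 0).trans ?_
  rw [perturb_zero]
  exact oracleComplexity_map_le _ _ _

theorem IsBorderProjection.borderOracleComplexity_le (h : IsBorderProjection f g) :
    borderOracleComplexity g f ≤ M + 1 := by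
  obtain ⟨p, hp⟩ := h
  exact (AlgRed.borderOracleComplexity_le g f p).trans (oracleComplexity_le_of_isProjection hp)

end Projections

variable {f g : PolyFamily F}

theorem PProj.borderPProj (h : PProj f g) : BorderPProj f g := by
  obtain ⟨t, ht, h⟩ := h
  exact ⟨t, ht, fun n => (h n).isBorderProjection⟩

theorem CRed.borderCRed (h : CRed f g) : BorderCRed f g := by
  obtain ⟨t, ht, h⟩ := h
  exact ⟨t, ht, h.mono fun n => borderOracleComplexity_le_oracleComplexity _ _⟩

theorem PProj.cRed (hg : PolyBounded g.nvars) (h : PProj f g) : CRed f g := by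
  obtain ⟨t, ht, h⟩ := h
  exact ⟨t, ht, (hg.comp ht).add_one.mono fun n => oracleComplexity_le_of_isProjection (h n)⟩

theorem BorderPProj.borderCRed (hg : PolyBounded g.nvars) (h : BorderPProj f g) :
    BorderCRed f g := by
  obtain ⟨t, ht, h⟩ := h
  exact ⟨t, ht, (hg.comp ht).add_one.mono fun n => (h n).borderOracleComplexity_le⟩

theorem oracleComplexity_hcPoly_sq_le (h2 : (2 : F) ≠ 0) (n : ℕ) :
    oracleComplexity (hcPoly F (3 * (1 + n)) ^ 2) (hcPoly F n) ≤
      2 * (3 * (1 + n) * (3 * (1 + n))) + 7 := by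
  have hproj (c : F) : IsProjection (1 + C c * hcPoly F n) (hcPoly F (3 * (1 + n))) :=
    (isLeaf_C c).isProjection_one_add_mul (isProjection_refl _)
  refine oracleComplexity_sq_le h2 ?_ ?_
  · simpa using hproj 1
  · simpa [sub_eq_add_neg] using hproj (-1)

theorem cRed_HC_HCsq (h2 : (2 : F) ≠ 0) : CRed (HC F) (HCsq F) := by
  refine ⟨fun n => 3 * (1 + n), ⟨3 * (1 + .X), by simp⟩,
    ⟨2 * ((3 * (1 + .X)) * (3 * (1 + .X))) + 7, fun n => ?_⟩⟩
  simp only [Polynomial.eval_add, Polynomial.eval_mul, Polynomial.eval_ofNat, Polynomial.eval_X,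
    Polynomial.eval_one]
  exact oracleComplexity_hcPoly_sq_le h2 n

end Reductions

section Border

variable {F : Type*} [Field F] {N : ℕ}

theorem map_algebraMap_map_C (f : MvPolynomial (Fin N) F) :
    map (algebraMap (Polynomial F) (RatFunc F)) (map Polynomial.C f) = extend f := by
  rw [map_map]
  rfl

theorem perturb_C_X_mul (f h : MvPolynomial (Fin N) F) :
    perturb f (C .X * map Polynomial.C h) = extend f + C RatFunc.X ^ 2 * extend h := by
  rw [perturb, map_mul, map_C, RatFunc.algebraMap_X, map_algebraMap_map_C]
  ring

theorem isBorderProjection_borderPad (f : MvPolynomial (Fin N) F) :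
    IsBorderProjection f (borderPad f) := by
  let ε : RatFunc F := .X
  let v : Fin (N + 2) → MvPolynomial (Fin N) (RatFunc F) := Fin.append X ![C (ε ^ 2), C ε⁻¹]
  have hv (i : Fin (N + 2)) : IsLeaf (v i) := by
    induction i using Fin.addCases with
    | left i => simpa [v] using isLeaf_X i
    | right i =>
      simp only [v, Fin.append_right]
      fin_cases i
      exacts [isLeaf_C _, isLeaf_C _]
  have hvX : v ∘ Fin.castAdd 2 = X := funext fun i => Fin.append_left _ _ i
  have hε : (C ε⁻¹ : MvPolynomial (Fin N) (RatFunc F)) * C ε = 1 := by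
    rw [← C_mul, inv_mul_cancel₀ RatFunc.X_ne_zero, C_1]
  refine ⟨C .X * map Polynomial.C (f ^ 2), isProjection_iff.2 ⟨v, hv, ?_⟩⟩
  rw [perturb_C_X_mul]
  simp only [extend]
  rw [map_borderPad, aeval_borderPad, hvX, aeval_X_left_apply]
  simp only [v, Fin.append_right, Matrix.cons_val, map_pow]
  linear_combination
    -(1 + C ε⁻¹ * C ε) * (map RatFunc.C f + C ε ^ 2 * map RatFunc.C f ^ 2) * hε

theorem borderPProj_HC_PFam : BorderPProj (HC F) (PFam F) :=
  ⟨id, ⟨.X, by simp⟩, fun n => isBorderProjection_borderPad (hcPoly F n)⟩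

end Border

section IntegrallyClosed

variable {σ R S : Type*} [CommRing R] [CommRing S] [Algebra R S]

theorem mem_range_map_of_pow_mem_range [IsIntegrallyClosedIn R S] {q : MvPolynomial σ S} {n : ℕ}
    (hn : 0 < n) (hq : q ^ n ∈ Set.range (map (σ := σ) (algebraMap R S))) :
    q ∈ Set.range (map (σ := σ) (algebraMap R S)) := by
  let _ : Algebra (MvPolynomial σ R) (MvPolynomial σ S) := algebraMvPolynomial
  obtain ⟨p, hp⟩ := hq
  have hint : IsIntegral (MvPolynomial σ R) q := .of_pow hn (hp ▸ isIntegral_algebraMap)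
  refine mem_range_map_iff_coeffs_subset.2 fun c hc => ?_
  obtain ⟨d, -, rfl⟩ := mem_coeffs_iff.1 hc
  exact IsIntegrallyClosedIn.isIntegral_iff.1 (isIntegral_iff_isIntegral_coeff.1 hint d)

theorem isSquare_of_isSquare_map [IsIntegrallyClosedIn R S] {p : MvPolynomial σ R}
    (h : IsSquare (map (algebraMap R S) p)) : IsSquare p := by
  obtain ⟨q, hq⟩ := h
  rw [← sq] at hq
  obtain ⟨r, rfl⟩ := mem_range_map_of_pow_mem_range two_pos ⟨p, hq⟩
  rw [sq, ← map_mul] at hq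
  exact ⟨r, map_injective _ (IsIntegralClosure.algebraMap_injective R R S) hq⟩

end IntegrallyClosed

section Obstructions

variable {F : Type*} [Field F] {N M : ℕ}

theorem perturb_eq_map (f : MvPolynomial (Fin N) F) (h : MvPolynomial (Fin N) (Polynomial F)) :
    perturb f h = map (algebraMap (Polynomial F) (RatFunc F))
      (map Polynomial.C f + C .X * h) := by
  rw [map_add, map_mul, map_C, RatFunc.algebraMap_X, map_algebraMap_map_C, perturb]

theorem isSquare_of_isSquare_perturb {f : MvPolynomial (Fin N) F}
    {h : MvPolynomial (Fin N) (Polynomial F)} (hsq : IsSquare (perturb f h)) : IsSquare f := by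
  rw [perturb_eq_map] at hsq
  have hreduce := (isSquare_of_isSquare_map hsq).map (map (Polynomial.evalRingHom (0 : F)))
  have hC : (Polynomial.evalRingHom (0 : F)).comp Polynomial.C = RingHom.id F := by ext; simp
  simpa [map_map, hC, map_id] using hreduce

theorem IsBorderProjection.isSquare {f : MvPolynomial (Fin N) F} {g : MvPolynomial (Fin M) F}
    (h : IsBorderProjection f g) (hg : IsSquare g) : IsSquare f := by
  obtain ⟨p, α, hα⟩ := h
  refine isSquare_of_isSquare_perturb (h := p) ?_
  rw [hα, extend]
  exact (hg.map _).map _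

theorem even_natDegree_sq_mul_add_sq (a u : Polynomial F) :
    Even (a ^ 2 * (u + u ^ 2)).natDegree := by
  rcases eq_or_ne (a ^ 2 * (u + u ^ 2)) 0 with h0 | h0
  · simp [h0]
  have hfactor : a ^ 2 * (u + u ^ 2) = a ^ 2 * (u * (u + Polynomial.C 1)) := by
    rw [Polynomial.C_1]
    ring
  rw [hfactor] at h0 ⊢
  have hu := right_ne_zero_of_mul h0
  rw [Polynomial.natDegree_mul (left_ne_zero_of_mul h0) hu, Polynomial.natDegree_pow,
    Polynomial.natDegree_mul (left_ne_zero_of_mul hu) (right_ne_zero_of_mul hu),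
    Polynomial.natDegree_add_C]
  exact (even_two_mul _).add (Even.add_self _)

theorem IsProjection.even_natDegree_of_borderPad {f : MvPolynomial (Fin N) F}
    {g : MvPolynomial (Fin M) F} (h : IsProjection f (borderPad g))
    (φ : MvPolynomial (Fin N) F →ₐ[F] Polynomial F) : Even (φ f).natDegree := by
  obtain ⟨α, rfl⟩ := h
  rw [aeval_borderPad, ← mul_pow, map_mul, map_pow, map_add, map_pow]
  exact even_natDegree_sq_mul_add_sq _ _

variable (F) in
theorem exists_algHom_hcPoly_eq_X {n : ℕ} (hn : 0 < n) :
    ∃ φ : MvPolynomial (Fin (n * n)) F →ₐ[F] Polynomial F, φ (hcPoly F n) = .X := by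
  let w : Fin n → Polynomial F := Function.update 1 ⟨0, hn⟩ .X
  refine ⟨aeval fun k => if (finProdFinEquiv.symm k).2 = finRotate n (finProdFinEquiv.symm k).1
    then w (finProdFinEquiv.symm k).1 else 0, ?_⟩
  simp only [aeval_hcPoly, symm_apply_apply]
  rw [hamSum_weighted_perm (isFullCycle_finRotate n) w]
  simp [w, Finset.prod_update_of_mem]

theorem not_borderPProj_HC_HCsq : ¬ BorderPProj (HC F) (HCsq F) := by
  rintro ⟨t, -, h⟩
  obtain ⟨φ, hφ⟩ := exists_algHom_hcPoly_eq_X F one_pos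
  have hsq : IsSquare (hcPoly F 1) := (h 1).isSquare (IsSquare.sq (hcPoly F (t 1)))
  exact Polynomial.irreducible_X.not_isSquare (hφ ▸ hsq.map φ)

theorem not_pProj_HC_PFam : ¬ PProj (HC F) (PFam F) := by
  rintro ⟨t, -, h⟩
  obtain ⟨φ, hφ⟩ := exists_algHom_hcPoly_eq_X F one_pos
  have heven : Even (φ (hcPoly F 1)).natDegree := IsProjection.even_natDegree_of_borderPad (h 1) φ
  simp [hφ] at heven

end Obstructions

end AlgRed

theorem theorem2_general (F : Type*) [Field F] (h2 : (2 : F) ≠ 0) :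
    (VNPC (F := F) PProj ⊆ VNPC CRed ∧
      VNPC (F := F) PProj ⊆ VNPC BorderPProj ∧
      VNPC (F := F) CRed ⊆ VNPC BorderCRed ∧
      VNPC (F := F) BorderPProj ⊆ VNPC BorderCRed) ∧
    (¬ VNPC (F := F) CRed ⊆ VNPC PProj ∧
      ¬ VNPC (F := F) BorderPProj ⊆ VNPC PProj ∧
      ¬ VNPC (F := F) CRed ⊆ VNPC BorderPProj ∧
      ¬ VNPC (F := F) BorderCRed ⊆ VNPC BorderPProj) ∧
    (HCsq F ∈ VNPC CRed ∧ HCsq F ∉ VNPC BorderPProj) ∧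
    (PFam F ∈ VNPC BorderPProj ∧ PFam F ∉ VNPC PProj) := by
  have hp_c : VNPC (F := F) PProj ⊆ VNPC CRed := fun _ ⟨hf, h⟩ => ⟨hf, h.cRed hf.1.1⟩
  have hp_bp : VNPC (F := F) PProj ⊆ VNPC BorderPProj := fun _ ⟨hf, h⟩ => ⟨hf, h.borderPProj⟩
  have hc_bc : VNPC (F := F) CRed ⊆ VNPC BorderCRed := fun _ ⟨hf, h⟩ => ⟨hf, h.borderCRed⟩
  have hbp_bc : VNPC (F := F) BorderPProj ⊆ VNPC BorderCRed :=
    fun _ ⟨hf, h⟩ => ⟨hf, h.borderCRed hf.1.1⟩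
  have hsq_mem : HCsq F ∈ VNPC CRed := ⟨HCsq_mem_VNP F, cRed_HC_HCsq h2⟩
  have hsq_notMem : HCsq F ∉ VNPC BorderPProj := fun h => not_borderPProj_HC_HCsq h.2
  have hP_mem : PFam F ∈ VNPC BorderPProj := ⟨PFam_mem_VNP F, borderPProj_HC_PFam⟩
  have hP_notMem : PFam F ∉ VNPC PProj := fun h => not_pProj_HC_PFam h.2
  exact ⟨⟨hp_c, hp_bp, hc_bc, hbp_bc⟩,
    ⟨fun h => hsq_notMem (hp_bp (h hsq_mem)), fun h => hP_notMem (h hP_mem),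
      fun h => hsq_notMem (h hsq_mem), fun h => hsq_notMem (h (hc_bc hsq_mem))⟩,
    ⟨hsq_mem, hsq_notMem⟩, ⟨hP_mem, hP_notMem⟩⟩

theorem theorem2 (F : Type) [Field F]
    (hF : Nonempty (F ≃+* ℚ) ∨ Nonempty (F ≃+* ℝ) ∨ Nonempty (F ≃+* ℂ)) :
    -- the inclusions (solid arrows)
    (VNPC (F := F) PProj ⊆ VNPC CRed ∧
      VNPC (F := F) PProj ⊆ VNPC BorderPProj ∧
      VNPC (F := F) CRed ⊆ VNPC BorderCRed ∧
      VNPC (F := F) BorderPProj ⊆ VNPC BorderCRed) ∧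
    -- the non-inclusions (dashed arrows)
    (¬ VNPC (F := F) CRed ⊆ VNPC PProj ∧
      ¬ VNPC (F := F) BorderPProj ⊆ VNPC PProj ∧
      ¬ VNPC (F := F) CRed ⊆ VNPC BorderPProj ∧
      ¬ VNPC (F := F) BorderCRed ⊆ VNPC BorderPProj) ∧
    -- the separating families
    (HCsq F ∈ VNPC CRed ∧ HCsq F ∉ VNPC BorderPProj) ∧
    (PFam F ∈ VNPC BorderPProj ∧ PFam F ∉ VNPC PProj) := by
  refine theorem2_general F fun h => ?_
  rcases hF with ⟨⟨e⟩⟩ | ⟨⟨e⟩⟩ | ⟨⟨e⟩⟩ <;>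
    exact two_ne_zero ((map_ofNat e 2).symm.trans (by rw [h, map_zero]))
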